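/- Preferential attachment process. For parameter $1$, let $G_1^1$ be one vertex $u_1$ with one loop; for $k \ge 2$, $G_1^k$ arises from $G_1^{k-1}$ by adding a vertex $u_k$ and one edge from $u_k$ to $u_i$, where, given the past, $i = s$ with probability $\frac{\deg(u_s)}{2k-1}$ for $1 \le s \le k-1$ ($\deg$ being the degree in $G_1^{k-1}$) and $i = k$ with probability $\frac{1}{2k-1}$. A loop contributes $2$ to the degree. For an integer $m \ge 1$, the multigraph $G_m^n$ with vertices $v_1,\dots,v_n$ is obtained from $G_1^{mn}$ by merging $u_{(i-1)m+1},\dots,u_{im}$ into $v_i$ for each $i$, keeping all edges, so that all the graphs $G_m^1, G_m^2, \dots$ live on one probability space. For a set $S$ of vertices of $G_m^t$ and $n \ge t$, let $d_m^n(S)$ be the sum of the degrees in $G_m^n$ of the vertices in $S$. Theorem. There is an absolute constant $C$ such that the following holds. Let $0 < \varepsilon \le 1/40$, let $t, m \ge 1$ be integers with $t > \varepsilon^{-6}$, let $S \subseteq \{v_1,\dots,v_t\}$, and let $d$ be a value that $d_m^t(S)$ takes with positive probability. Then $$\mathbb{P}\Bigl[ (1-\varepsilon)\sqrt{\tfrac{n}{t}}\;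 d_m^t(S) < d_m^n(S) < (1+\varepsilon)\sqrt{\tfrac{n}{t}}\; d_m^t(S) \text{ for all } n \ge t \Bigm| d_m^t(S) = d \Bigr] \;\ge\; 1 - \ln(15t)\, e^{-\varepsilon^{C} d}.$$ -/

import Mathlib

open MeasureTheory ProbabilityTheory
open scoped ENNReal

namespace PrefAttach

/-- A finite multigraph (parallel edges and loops allowed) with vertex type `V`, given by the
multiset of its edges. An edge is written as a pair of end points; `degree` ignores the order
of the two entries. -/
structure Multigraph (V : Type) where
  edges : Multiset (V × V)

/-- The degree of `v`: the number of edge ends at `v`; a loop counts twice. -/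
def Multigraph.degree {V : Type} [DecidableEq V] (G : Multigraph V) (v : V) : ℕ :=
  (G.edges.map Prod.fst).count v + (G.edges.map Prod.snd).count v

/-- The degree of a set of vertices: the sum of the degrees of its members. -/
def Multigraph.setDegree {V : Type} [DecidableEq V] (G : Multigraph V) (S : Finset V) : ℕ :=
  ∑ v ∈ S, G.degree v

/-- Merge vertices along `f : V → W`: all the vertices in a fibre of `f` become one vertex, and
every edge is kept (edges inside a fibre become loops). -/
def Multigraph.merge {V W : Type} (G : Multigraph V) (f : V → W) : Multigraph W where
  edges := G.edges.map (Prod.map f f)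

/-- The graph on the vertices `0, …, n - 1` in which vertex `i` brings one edge, from `i` to
the vertex `c i ∈ {0, …, i}`. (Vertex `i` here is the `(i+1)`-st vertex to arrive.) -/
def graphOfChoices (n : ℕ) (c : (i : Fin n) → Fin (i.val + 1)) : Multigraph (Fin n) where
  edges := (Finset.univ : Finset (Fin n)).val.map
    (fun i => (i, Fin.castLE (Nat.succ_le_of_lt i.isLt) (c i)))

/-- The probability that the vertex joining a graph with `n` vertices (so, the vertex number
`t = n + 1`, with `2 t - 1 = 2 n + 1`) sends its edge to vertex `s`: proportional to the degree
for the old vertices `s < n`, and with weight one for the new vertex itself. -/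
noncomputable def attachProb {n : ℕ} (G : Multigraph (Fin n)) (s : Fin (n + 1)) : ℝ≥0∞ :=
  if h : s.val < n then (G.degree ⟨s.val, h⟩ : ℝ≥0∞) / (2 * n + 1) else 1 / (2 * n + 1)

lemma sum_degree_graphOfChoices (n : ℕ) (c : (i : Fin n) → Fin (i.val + 1)) :
    ∑ v, (graphOfChoices n c).degree v = 2 * n := by
  simp only [Multigraph.degree, Finset.sum_add_distrib]
  rw [Multiset.sum_count_eq_card (by simp), Multiset.sum_count_eq_card (by simp)]
  simp [graphOfChoices, two_mul]

lemma sum_attachProb (n : ℕ) (c : (i : Fin n) → Fin (i.val + 1)) :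
    ∑ s, attachProb (graphOfChoices n c) s = 1 := by
  rw [Fin.sum_univ_castSucc]
  simp only [attachProb, Fin.val_castSucc, Fin.is_lt, dite_true, Fin.eta, Fin.val_last,
    lt_irrefl, dite_false]
  simp only [div_eq_mul_inv]
  rw [← Finset.sum_mul, ← Nat.cast_sum, sum_degree_graphOfChoices, ← add_mul]
  push_cast
  refine ENNReal.mul_inv_cancel (by simp) ?_
  exact_mod_cast ENNReal.natCast_ne_top (2 * n + 1)

/-- The law of the vertex chosen by the newcomer, given the choices of the first `n` vertices. -/
noncomputable def attachPMF (n : ℕ) (c : (i : Fin n) → Fin (i.val + 1)) : PMF (Fin (n + 1)) :=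
  PMF.ofFintype (attachProb (graphOfChoices n c)) (sum_attachProb n c)

/-- The choices made by all the vertices: vertex `i` chooses `ω i ∈ {0, …, i}`. -/
abbrev Choices : Type := (i : ℕ) → Fin (i + 1)

/-- A history of the choices made by the vertices `0, …, k`. -/
abbrev History (k : ℕ) : Type := (i : Finset.Iic k) → Fin (i.val + 1)

/-- The transition kernel of the process: from the choices of the vertices `0, …, k` to the
choice of vertex `k + 1`. -/
noncomputable def step (k : ℕ) : Kernel (History k) (Fin (k + 1 + 1)) where
  toFun x := (attachPMF (k + 1)
    (fun i => x ⟨i.val, Finset.mem_Iic.2 (Nat.le_of_lt_succ i.isLt)⟩)).toMeasure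
  measurable' := measurable_of_countable _

instance (k : ℕ) : IsMarkovKernel (step k) :=
  ⟨fun _ => PMF.toMeasure.isProbabilityMeasure _⟩

/-- The law of the preferential attachment process: vertex `0` starts with a loop, and every
later vertex chooses its neighbour according to `step`. -/
noncomputable def law : Measure Choices :=
  Kernel.traj (X := fun i : ℕ => Fin (i + 1)) step 0 (fun _ => 0)

instance : IsProbabilityMeasure law := by unfold law; infer_instance

/-- The graph of the process with parameter `1` at time `n`. -/
def graphOne (n : ℕ) (ω : Choices) : Multigraph (Fin n) :=
  graphOfChoices n (fun i => ω i.val)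

/-- The graph of the process with parameter `m` at time `n`: in the graph with parameter `1` at
time `n * m`, the vertices `m i, …, m i + m - 1` are merged into vertex `i`. -/
def graph (m n : ℕ) (ω : Choices) : Multigraph (Fin n) :=
  (graphOne (n * m) ω).merge Fin.divNat

/-- For a set `S` of vertices among the first `t`, the degree of `S` at time `n ≥ t` in the
process with parameter `m`. -/
def deg (m : ℕ) {t : ℕ} (S : Finset (Fin t)) (n : ℕ) (h : t ≤ n) (ω : Choices) : ℕ :=
  (graph m n ω).setDegree (S.map (Fin.castLEEmb h))

end PrefAttach

/-!
In the process with parameter `1`, let `D k` be the number of edge ends at time `k` in a fixed set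
of vertices that have all arrived by time `M`. Given the past, `D` increases by one with
probability `D k / (2 k + 1)`, and otherwise stays put; so `decay M k * D k` has constant mean,
where `decay M k = ∏_{M < j ≤ k} (2 j - 1) / (2 j)`. Correcting `l * decay M k` by a quadratic term
turns `exp (l * decay M k * D k)` into a supermartingale, as long as `|l| ≤ 1 / 5`, and Ville's
inequality bounds its supremum over all `k ≥ M` at once. Taking `l = ± ε / 8` gives the two tails.
Finally `decay M k = √(M / k)` up to a relative error of order `1 / M`, which is absorbed by `ε`
when `1 ≤ ε * M`. Merging vertices does not change the degree of a set, which reduces the process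
with parameter `m` at times `n ≥ t` to the one with parameter `1` at times `n m ≥ t m = M`.
-/

namespace PrefAttach

section Ville

variable {Ω : Type*} {mΩ : MeasurableSpace Ω} {μ : Measure Ω}

lemma mul_measure_inter_add_setLIntegral_sdiff_le {f : Ω → ℝ≥0∞} (hf : Measurable f) (c : ℝ≥0∞)
    (B : Set Ω) :
    c * μ (B ∩ {ω | c ≤ f ω}) + ∫⁻ ω in B \ {ω | c ≤ f ω}, f ω ∂μ ≤ ∫⁻ ω in B, f ω ∂μ := by
  rw [← lintegral_inter_add_sdiff f B (measurableSet_le measurable_const hf), ← setLIntegral_const]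
  gcongr ?_ + _
  exact setLIntegral_mono hf fun ω hω => hω.2

lemma mul_measure_accumulate_add_setLIntegral_le {ℱ : Filtration ℕ mΩ} {X : ℕ → Ω → ℝ≥0∞}
    (hX : ∀ n, Measurable[ℱ n] (X n))
    (hdec : ∀ n B, MeasurableSet[ℱ n] B → ∫⁻ ω in B, X (n + 1) ω ∂μ ≤ ∫⁻ ω in B, X n ω ∂μ)
    (c : ℝ≥0∞) (n : ℕ) :
    c * μ (Set.accumulate (fun k => {ω | c ≤ X k ω}) n) +
        ∫⁻ ω in (Set.accumulate (fun k => {ω | c ≤ X k ω}) n)ᶜ, X n ω ∂μ ≤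
      ∫⁻ ω, X 0 ω ∂μ := by
  set E : ℕ → Set Ω := fun n => {ω | c ≤ X n ω}
  set H : ℕ → Set Ω := Set.accumulate E
  have measurable_X n : Measurable (X n) := (hX n).mono (ℱ.le n) le_rfl
  have measurable_H n : MeasurableSet[ℱ n] (H n) :=
    .biUnion (Set.to_countable _) fun k hk => ℱ.mono hk _ (hX k measurableSet_Ici)
  induction n with
  | zero =>
    simpa [H, Set.accumulate_zero_nat, Set.compl_eq_univ_sdiff] using
      mul_measure_inter_add_setLIntegral_sdiff_le (μ := μ) (measurable_X 0) c Set.univ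
  | succ n ih =>
    have hH : H (n + 1) = H n ∪ E (n + 1) := Set.accumulate_succ E n
    have hμ : μ (H (n + 1)) = μ (H n) + μ ((H n)ᶜ ∩ E (n + 1)) := by
      rw [hH, ← measure_add_sdiff (ℱ.le n _ (measurable_H n)).nullMeasurableSet, Set.sdiff_eq,
        Set.inter_comm]
    have hcompl : (H (n + 1))ᶜ = (H n)ᶜ \ E (n + 1) := by
      rw [hH, Set.compl_union, Set.sdiff_eq]
    calc c * μ (H (n + 1)) + ∫⁻ ω in (H (n + 1))ᶜ, X (n + 1) ω ∂μ
        = c * μ (H n) + (c * μ ((H n)ᶜ ∩ E (n + 1)) +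
            ∫⁻ ω in (H n)ᶜ \ E (n + 1), X (n + 1) ω ∂μ) := by
          rw [hμ, hcompl, mul_add, add_assoc]
      _ ≤ c * μ (H n) + ∫⁻ ω in (H n)ᶜ, X (n + 1) ω ∂μ := by
          gcongr _ + ?_
          exact mul_measure_inter_add_setLIntegral_sdiff_le (measurable_X (n + 1)) c _
      _ ≤ c * μ (H n) + ∫⁻ ω in (H n)ᶜ, X n ω ∂μ := by
          gcongr _ + ?_
          exact hdec n _ (measurable_H n).compl
      _ ≤ ∫⁻ ω, X 0 ω ∂μ := ih

/-- Ville's inequality: the second hypothesis says that `X` is a supermartingale. -/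
lemma mul_measure_exists_le_le_lintegral {ℱ : Filtration ℕ mΩ} {X : ℕ → Ω → ℝ≥0∞}
    (hX : ∀ n, Measurable[ℱ n] (X n))
    (hdec : ∀ n B, MeasurableSet[ℱ n] B → ∫⁻ ω in B, X (n + 1) ω ∂μ ≤ ∫⁻ ω in B, X n ω ∂μ)
    (c : ℝ≥0∞) :
    c * μ {ω | ∃ n, c ≤ X n ω} ≤ ∫⁻ ω, X 0 ω ∂μ := by
  rw [Set.ofPred_exists, measure_iUnion_eq_iSup_accumulate, ENNReal.mul_iSup]
  exact iSup_le fun n =>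
    le_self_add.trans (mul_measure_accumulate_add_setLIntegral_le hX hdec c n)

lemma setLIntegral_cond {A B : Set Ω} (hB : MeasurableSet B) (f : Ω → ℝ≥0∞) :
    ∫⁻ ω in B, f ω ∂μ[|A] = (μ A)⁻¹ * ∫⁻ ω in B ∩ A, f ω ∂μ := by
  rw [ProbabilityTheory.cond, Measure.restrict_smul, Measure.restrict_restrict hB,
    lintegral_smul_measure, smul_eq_mul]

end Ville

section Degrees

lemma Multigraph.setDegree_eq_sum_edges {V : Type} [DecidableEq V] (G : Multigraph V)
    (S : Finset V) :
    G.setDegree S = (G.edges.map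
      (fun e => (if e.1 ∈ S then 1 else 0) + (if e.2 ∈ S then 1 else 0))).sum := by
  obtain ⟨E⟩ := G
  simp only [Multigraph.setDegree, Multigraph.degree]
  induction E using Multiset.induction with
  | empty => simp
  | cons e E ih =>
    simp only [Multiset.map_cons, Multiset.count_cons, Multiset.sum_cons, ← ih,
      Finset.sum_add_distrib, Finset.sum_ite_eq']
    ring

lemma Multigraph.setDegree_merge {V W : Type} [Fintype V] [DecidableEq V] [DecidableEq W]
    (G : Multigraph V) (f : V → W) (S : Finset W) :
    (G.merge f).setDegree S = G.setDegree {v | f v ∈ S} := by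
  simp [setDegree_eq_sum_edges, merge]

/-- The degree of a set `T` of vertices in the process with parameter `1` at time `n`: the number
of ends in `T` among the edges brought by the vertices `0, …, n - 1`. The set `T` may contain
vertices that have not arrived yet. -/
def endCount (T : Finset ℕ) (n : ℕ) (ω : Choices) : ℕ :=
  ∑ i ∈ Finset.range n, ((if i ∈ T then 1 else 0) + (if (ω i).val ∈ T then 1 else 0))

lemma endCount_succ {T : Finset ℕ} {n : ℕ} (hn : n ∉ T) (ω : Choices) :
    endCount T (n + 1) ω = endCount T n ω + if (ω n).val ∈ T then 1 else 0 := by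
  simp [endCount, Finset.sum_range_succ, hn]

lemma endCount_le_two_mul (T : Finset ℕ) (n : ℕ) (ω : Choices) : endCount T n ω ≤ 2 * n := by
  have : endCount T n ω ≤ ∑ i ∈ Finset.range n, 2 :=
    Finset.sum_le_sum fun i _ => by split_ifs <;> norm_num
  simpa [mul_comm] using this

lemma setDegree_graphOne (T : Finset ℕ) (n : ℕ) (ω : Choices) :
    (graphOne n ω).setDegree {i | i.val ∈ T} = endCount T n ω := by
  rw [Multigraph.setDegree_eq_sum_edges, endCount, Finset.sum_range]
  simp only [graphOne, graphOfChoices, Multiset.map_map, Function.comp_def, Finset.mem_filter,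
    Finset.mem_univ, true_and]
  rfl

/-- The vertices of the process with parameter `1` that are merged into a member of `S` in the
process with parameter `m`. -/
def mergedInto (m : ℕ) {t : ℕ} (S : Finset (Fin t)) : Finset ℕ :=
  {i ∈ Finset.range (t * m) | i / m ∈ S.map Fin.valEmbedding}

lemma mergedInto_subset_range (m : ℕ) {t : ℕ} (S : Finset (Fin t)) :
    mergedInto m S ⊆ Finset.range (t * m) :=
  Finset.filter_subset _ _

lemma divNat_mem_map_castLEEmb_iff {m n t : ℕ} (S : Finset (Fin t)) (h : t ≤ n)
    (i : Fin (n * m)) : i.divNat ∈ S.map (Fin.castLEEmb h) ↔ i.val ∈ mergedInto m S := by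
  have hm : 0 < m := Nat.pos_of_mul_pos_left i.pos
  simp only [mergedInto, Finset.mem_map, Finset.mem_filter, Finset.mem_range]
  constructor
  · rintro ⟨v, hv, hvi⟩
    have hdiv : v.val = i.val / m := by simpa using congrArg Fin.val hvi
    exact ⟨(Nat.div_lt_iff_lt_mul hm).1 (hdiv ▸ v.isLt), v, hv, hdiv⟩
  · rintro ⟨_, v, hv, hvi⟩
    exact ⟨v, hv, Fin.ext (by simpa using hvi)⟩

lemma deg_eq_endCount {m t : ℕ} (S : Finset (Fin t)) {n : ℕ} (h : t ≤ n) (ω : Choices) :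
    deg m S n h ω = endCount (mergedInto m S) (n * m) ω := by
  simp only [deg, graph, Multigraph.setDegree_merge, divNat_mem_map_castLEEmb_iff,
    setDegree_graphOne]

end Degrees

section Step

variable {T : Finset ℕ} {n : ℕ}

lemma sum_attachProb_mem (hn : n ∉ T) (ω : Choices) :
    ∑ s with s.val ∈ T, attachProb (graphOne n ω) s =
      ENNReal.ofReal (endCount T n ω / (2 * n + 1)) := by
  have hcast : (2 * n + 1 : ℝ≥0∞) = ENNReal.ofReal (2 * n + 1) := by
    rw [ENNReal.ofReal_add (by positivity) zero_le_one, ENNReal.ofReal_mul zero_le_two]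
    simp
  rw [ENNReal.ofReal_div_of_pos (by positivity), ENNReal.ofReal_natCast, ← hcast,
    ← setDegree_graphOne, Multigraph.setDegree, Finset.sum_filter, Finset.sum_filter,
    Fin.sum_univ_castSucc, div_eq_mul_inv, Nat.cast_sum, Finset.sum_mul]
  simp [attachProb, hn, div_eq_mul_inv, ite_mul]

lemma sum_attachProb_notMem (hn : n ∉ T) (ω : Choices) :
    ∑ s with s.val ∉ T, attachProb (graphOne n ω) s =
      ENNReal.ofReal (1 - endCount T n ω / (2 * n + 1)) := by
  rw [ENNReal.ofReal_sub _ (by positivity), ← sum_attachProb_mem hn, ENNReal.ofReal_one]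
  refine ENNReal.eq_sub_of_add_eq ?_ ?_
  · simp [sum_attachProb_mem hn]
  · rw [add_comm, Finset.sum_filter_add_sum_filter_not]
    exact sum_attachProb n _

lemma sum_ofReal_ite_mul_attachProb (hn : n ∉ T) {a b : ℝ} (ha : 0 ≤ a) (hb : 0 ≤ b)
    (ω : Choices) :
    ∑ s : Fin (n + 1), ENNReal.ofReal (if s.val ∈ T then a else b) * attachProb (graphOne n ω) s =
      ENNReal.ofReal (a * (endCount T n ω / (2 * n + 1)) +
        b * (1 - endCount T n ω / (2 * n + 1))) := by
  have hle : (endCount T n ω : ℝ) / (2 * n + 1) ≤ 1 := by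
    rw [div_le_one (by positivity)]
    exact_mod_cast (endCount_le_two_mul T n ω).trans (Nat.le_succ _)
  rw [ENNReal.ofReal_add (by positivity) (mul_nonneg hb (sub_nonneg.2 hle)), ENNReal.ofReal_mul ha,
    ENNReal.ofReal_mul hb, ← sum_attachProb_mem hn, ← sum_attachProb_notMem hn, Finset.mul_sum,
    Finset.mul_sum, Finset.sum_filter, Finset.sum_filter, ← Finset.sum_add_distrib]
  refine Finset.sum_congr rfl fun s _ => ?_
  split_ifs <;> simp

lemma lintegral_traj_succ {X : ℕ → Type*} [∀ n, MeasurableSpace (X n)]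
    {κ : (n : ℕ) → Kernel ((i : Finset.Iic n) → X i) (X (n + 1))} [∀ n, IsMarkovKernel (κ n)]
    {a b : ℕ} (hab : a ≤ b) (x₀ : (i : Finset.Iic a) → X i)
    {F : ((i : Finset.Iic b) → X i) → X (b + 1) → ℝ≥0∞} (hF : Measurable (Function.uncurry F)) :
    ∫⁻ x, F (Preorder.frestrictLe b x) (x (b + 1)) ∂Kernel.traj κ a x₀ =
      ∫⁻ x, ∫⁻ s, F (Preorder.frestrictLe b x) s ∂κ b (Preorder.frestrictLe b x)
        ∂Kernel.traj κ a x₀ := by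
  calc ∫⁻ x, F (Preorder.frestrictLe b x) (x (b + 1)) ∂Kernel.traj κ a x₀
      = ∫⁻ p, Function.uncurry F p ∂(Kernel.traj κ a x₀).map
          (fun x => (Preorder.frestrictLe b x, x (b + 1))) :=
        (lintegral_map hF
          ((Preorder.measurable_frestrictLe b).prodMk (measurable_pi_apply _))).symm
    _ = ∫⁻ y, ∫⁻ s, F y s ∂κ b y ∂Kernel.partialTraj κ a b x₀ := by
        rw [← Kernel.partialTraj_compProd_eq_map_traj hab, Measure.lintegral_compProd hF]
        rfl
    _ = _ := by
        rw [← Kernel.traj_map_frestrictLe_apply,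
          lintegral_map hF.lintegral_kernel_prod_right (Preorder.measurable_frestrictLe b)]

/-- The information carried by the choices of the first `n` vertices. -/
def past : Filtration ℕ (MeasurableSpace.pi : MeasurableSpace Choices) where
  seq n := cylinderEvents (Set.Iio n)
  mono' _ _ h := cylinderEvents_mono (Set.Iio_subset_Iio h)
  le' _ := cylinderEvents_le_pi

lemma past_succ_le_comap_frestrictLe (k : ℕ) :
    past (k + 1) ≤ MeasurableSpace.pi.comap
      (Preorder.frestrictLe (π := fun i : ℕ => Fin (i + 1)) k) := by
  refine iSup₂_le fun i hi => ?_
  have hik : i ∈ Finset.Iic k := Finset.mem_Iic.2 (Nat.lt_succ_iff.1 hi)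
  have heval : Measurable fun x : History k => x ⟨i, hik⟩ := measurable_pi_apply _
  exact (heval.comp
    (comap_measurable (Preorder.frestrictLe (π := fun i : ℕ => Fin (i + 1)) k))).comap_le

lemma measurable_endCount (T : Finset ℕ) (n : ℕ) : Measurable[past n] (endCount T n) := by
  refine @Finset.measurable_fun_sum _ _ _ _ _ _ (past n) _ _ fun i hi => ?_
  have : Measurable[past n] fun ω : Choices => ω i :=
    measurable_cylinderEvent_apply (Finset.mem_range.1 hi)
  exact (measurable_of_countable
    fun s : Fin (i + 1) => (if i ∈ T then 1 else 0) + (if s.val ∈ T then 1 else 0)).comp this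

lemma lintegral_law_eval (n : ℕ) {F : Choices → Fin (n + 1) → ℝ≥0∞}
    (hF : ∀ s, Measurable[past n] (F · s)) :
    ∫⁻ ω, F ω (ω n) ∂law = ∫⁻ ω, ∑ s, F ω s * attachProb (graphOne n ω) s ∂law := by
  cases n with
  | zero =>
    refine lintegral_congr fun ω => ?_
    simp [attachProb, Fin.fin_one_eq_zero (ω 0)]
  | succ k =>
    have hfac s : ∃ f : History k → ℝ≥0∞, Measurable f ∧ (F · s) = f ∘ Preorder.frestrictLe k :=
      ((hF s).mono (past_succ_le_comap_frestrictLe k) le_rfl).exists_eq_measurable_comp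
    choose f _ hf using hfac
    have hf' ω s : F ω s = f s (Preorder.frestrictLe k ω) := congrFun (hf s) ω
    simp only [hf', law]
    rw [lintegral_traj_succ (X := fun i : ℕ => Fin (i + 1)) (κ := step) (F := fun x s => f s x)
      (Nat.zero_le k) _ (measurable_of_countable _)]
    refine lintegral_congr fun ω => ?_
    rw [lintegral_fintype]
    refine Finset.sum_congr rfl fun s _ => ?_
    congr 1
    exact PMF.toMeasure_apply_singleton _ _ (measurableSet_singleton s)

end Step

section Tilt

/-- The reciprocal of the factor by which the mean degree of a set of vertices grows between the
times `M` and `k` of the process with parameter `1`. It has order `√(M / k)`. -/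
noncomputable def decay (M k : ℕ) : ℝ := ∏ j ∈ Finset.Ioc M k, (2 * j - 1 : ℝ) / (2 * j)

lemma decay_self (M : ℕ) : decay M M = 1 := by simp [decay]

lemma decay_succ {M k : ℕ} (h : M ≤ k) :
    decay M (k + 1) = decay M k * ((2 * k + 1) / (2 * k + 1 + 1)) := by
  rw [decay, Finset.prod_Ioc_succ_top h, decay]
  push_cast
  congr 2 <;> ring

lemma decay_pos {M k : ℕ} (h : M ≤ k) : 0 < decay M k := by
  induction k, h using Nat.le_induction with
  | base => simp [decay_self]
  | succ k h ih => rw [decay_succ h]; positivity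

lemma decay_le_one {M k : ℕ} (h : M ≤ k) : decay M k ≤ 1 := by
  induction k, h using Nat.le_induction with
  | base => simp [decay_self]
  | succ k h ih =>
    rw [decay_succ h]
    refine mul_le_one₀ ih (by positivity) ?_
    rw [div_le_one (by positivity)]
    linarith

lemma le_decay_sq_mul {M k : ℕ} (h : M ≤ k) : (M : ℝ) ≤ decay M k ^ 2 * k := by
  induction k, h using Nat.le_induction with
  | base => simp [decay_self]
  | succ k h ih =>
    refine ih.trans ?_
    rw [decay_succ h, mul_pow, mul_assoc]
    gcongr
    rw [div_pow, div_mul_eq_mul_div, le_div_iff₀ (by positivity)]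
    push_cast
    nlinarith

lemma decay_sq_mul_le {M k : ℕ} (h : M ≤ k) : decay M k ^ 2 * (2 * k + 1) ≤ 2 * M + 1 := by
  induction k, h using Nat.le_induction with
  | base => simp [decay_self]
  | succ k h ih =>
    refine le_trans ?_ ih
    rw [decay_succ h, mul_pow, mul_assoc]
    gcongr
    rw [div_pow, div_mul_eq_mul_div, div_le_iff₀ (by positivity)]
    push_cast
    nlinarith [sq_nonneg (k : ℝ)]

lemma one_le_decay_mul_sqrt {M k : ℕ} (hM : 0 < M) (h : M ≤ k) :
    1 ≤ decay M k * √(k / M) := by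
  have hM' : (0 : ℝ) < M := by exact_mod_cast hM
  rw [← one_le_sq_iff₀ (mul_nonneg (decay_pos h).le (Real.sqrt_nonneg _)), mul_pow,
    Real.sq_sqrt (by positivity), ← mul_div_assoc, one_le_div hM']
  exact le_decay_sq_mul h

lemma one_sub_mul_decay_mul_sqrt_le {M k : ℕ} {ε : ℝ} (h : M ≤ k) (hε : ε ≤ 1)
    (hεM : 1 ≤ ε * M) : (1 - ε) * (decay M k * √(k / M)) ≤ 1 - ε / 2 := by
  have hM : (0 : ℝ) < M := by
    by_contra! hM
    nlinarith [M.cast_nonneg (α := ℝ)]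
  have hε0 : 0 < ε := by
    by_contra! hε0
    nlinarith
  have hsq : decay M k ^ 2 * (k / M) ≤ 1 + ε / 2 := by
    rw [← mul_div_assoc, div_le_iff₀ hM]
    nlinarith [decay_sq_mul_le h, sq_nonneg (decay M k)]
  refine le_of_sq_le_sq ?_ (by linarith)
  calc ((1 - ε) * (decay M k * √(k / M))) ^ 2
      = (1 - ε) ^ 2 * (decay M k ^ 2 * (k / M)) := by
        rw [mul_pow, mul_pow, Real.sq_sqrt (by positivity)]
    _ ≤ (1 - ε) ^ 2 * (1 + ε / 2) := by gcongr
    _ ≤ (1 - ε / 2) ^ 2 := by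
        nlinarith [mul_nonneg hε0.le (sub_nonneg.2 hε),
          mul_nonneg (mul_nonneg hε0.le hε0.le) (sub_nonneg.2 hε)]

/-- The exponents for which `exp (tilt l (decay M k) * endCount T k ω)` is a supermartingale in
`k`. The linear term alone would balance the mean drift of the degree; the quadratic one pays for
the error in `exp x ≈ 1 + x`. -/
def tilt (l u : ℝ) : ℝ := l * u + 2 * l ^ 2 * u ^ 2

lemma mul_le_tilt (l u : ℝ) : l * u ≤ tilt l u :=
  le_add_of_nonneg_right (by positivity)

lemma tilt_sq_le {l u : ℝ} (hl : |l| ≤ 1 / 5) (hu : 0 ≤ u) (hu1 : u ≤ 1) :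
    tilt l u ^ 2 ≤ 2 * l ^ 2 * u ^ 2 := by
  have hlu : |l * u| ≤ 1 / 5 := by
    rw [abs_mul, abs_of_nonneg hu]
    exact (mul_le_of_le_one_right (abs_nonneg l) hu1).trans hl
  obtain ⟨hlu1, hlu2⟩ := abs_le.1 hlu
  have hfactor : (1 + 2 * (l * u)) ^ 2 ≤ 2 := by nlinarith
  calc tilt l u ^ 2 = l ^ 2 * u ^ 2 * (1 + 2 * (l * u)) ^ 2 := by rw [tilt]; ring
    _ ≤ l ^ 2 * u ^ 2 * 2 := by gcongr
    _ = 2 * l ^ 2 * u ^ 2 := by ring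

lemma abs_tilt_le_one {l u : ℝ} (hl : |l| ≤ 1 / 5) (hu : 0 ≤ u) (hu1 : u ≤ 1) :
    |tilt l u| ≤ 1 := by
  rw [← sq_le_one_iff_abs_le_one]
  calc tilt l u ^ 2 ≤ 2 * |l| ^ 2 * u ^ 2 := by simpa using tilt_sq_le hl hu hu1
    _ ≤ 2 * (1 / 5) ^ 2 * 1 ^ 2 := by gcongr
    _ ≤ 1 := by norm_num

lemma tilt_add_exp_sub_one_div_le {l u n : ℝ} (hl : |l| ≤ 1 / 5) (hu : 0 ≤ u) (hu1 : u ≤ 1)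
    (hn : 0 < n) :
    tilt l (u * (n / (n + 1))) + (Real.exp (tilt l (u * (n / (n + 1)))) - 1) / n ≤ tilt l u := by
  obtain ⟨v, hv⟩ : ∃ v, v = u * (n / (n + 1)) := ⟨_, rfl⟩
  have huv : u = v * ((n + 1) / n) := by rw [hv]; field_simp
  have hv0 : 0 ≤ v := by rw [hv]; positivity
  have hvu : v ≤ u := by
    rw [hv]
    exact mul_le_of_le_one_right hu (by rw [div_le_one (by positivity)]; linarith)
  have hexp : Real.exp (tilt l v) - 1 ≤ tilt l v + tilt l v ^ 2 := by
    have := (abs_le.1 (Real.abs_exp_sub_one_sub_id_le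
      (abs_tilt_le_one hl hv0 (hvu.trans hu1)))).2
    linarith
  rw [← hv]
  calc tilt l v + (Real.exp (tilt l v) - 1) / n
      ≤ tilt l v + (tilt l v + 2 * l ^ 2 * v ^ 2) / n := by
        gcongr
        exact hexp.trans (by gcongr; exact tilt_sq_le hl hv0 (hvu.trans hu1))
    _ ≤ tilt l v + (tilt l v + 2 * l ^ 2 * (v * u)) / n := by
        gcongr
        nlinarith
    _ = tilt l u := by
        rw [huv, tilt, tilt]
        field_simp
        ring

lemma exp_mul_bernoulli_le {s s' n y : ℝ} (hy : 0 ≤ y)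
    (h : s' + (Real.exp s' - 1) / n ≤ s) :
    Real.exp (s' * (y + 1)) * (y / n) + Real.exp (s' * y) * (1 - y / n) ≤ Real.exp (s * y) := by
  calc Real.exp (s' * (y + 1)) * (y / n) + Real.exp (s' * y) * (1 - y / n)
      = Real.exp (s' * y) * ((y / n) * (Real.exp s' - 1) + 1) := by
        rw [mul_add, Real.exp_add, mul_one]; ring
    _ ≤ Real.exp (s' * y) * Real.exp ((y / n) * (Real.exp s' - 1)) := by
        gcongr
        exact Real.add_one_le_exp _
    _ = Real.exp ((s' + (Real.exp s' - 1) / n) * y) := by rw [← Real.exp_add]; congr 1; ring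
    _ ≤ Real.exp (s * y) := by gcongr

end Tilt

section Tail

variable {T : Finset ℕ} {M : ℕ}

lemma setLIntegral_exp_mul_endCount_succ_le {n : ℕ} (hn : n ∉ T) {s s' : ℝ}
    (h : s' + (Real.exp s' - 1) / (2 * n + 1) ≤ s) {B : Set Choices}
    (hB : MeasurableSet[past n] B) :
    ∫⁻ ω in B, ENNReal.ofReal (Real.exp (s' * endCount T (n + 1) ω)) ∂law ≤
      ∫⁻ ω in B, ENNReal.ofReal (Real.exp (s * endCount T n ω)) ∂law := by
  set F : Choices → Fin (n + 1) → ℝ≥0∞ := fun ω i => B.indicator (fun ω => ENNReal.ofReal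
    (if i.val ∈ T then Real.exp (s' * (endCount T n ω + 1)) else Real.exp (s' * endCount T n ω))) ω
  have measurable_F i : Measurable[past n] (F · i) :=
    ((measurable_of_countable fun y : ℕ => ENNReal.ofReal (if i.val ∈ T then
      Real.exp (s' * (y + 1)) else Real.exp (s' * y))).comp (measurable_endCount T n)).indicator hB
  rw [← lintegral_indicator (past.le n _ hB), ← lintegral_indicator (past.le n _ hB)]
  calc _ = ∫⁻ ω, F ω (ω n) ∂law := by
        refine lintegral_congr fun ω => ?_
        by_cases hωT : (ω n).val ∈ T <;> simp [F, hωT, endCount_succ hn, Set.indicator]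
    _ = ∫⁻ ω, ∑ i, F ω i * attachProb (graphOne n ω) i ∂law := lintegral_law_eval n measurable_F
    _ ≤ _ := by
        refine lintegral_mono fun ω => ?_
        by_cases hω : ω ∈ B
        · simp only [F, Set.indicator_of_mem hω]
          rw [sum_ofReal_ite_mul_attachProb hn (by positivity) (by positivity)]
          exact ENNReal.ofReal_le_ofReal (exp_mul_bernoulli_le (by positivity) h)
        · simp [F, hω]

lemma measurableSet_endCount_eq (T : Finset ℕ) (n d : ℕ) :
    MeasurableSet[past n] {ω | endCount T n ω = d} :=
  measurable_endCount T n (measurableSet_singleton d)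

lemma setLIntegral_cond_exp_tilt_succ_le (hT : T ⊆ Finset.range M) (d : ℕ) {l : ℝ}
    (hl : |l| ≤ 1 / 5) {k : ℕ} (hk : M ≤ k) {B : Set Choices} (hB : MeasurableSet[past k] B) :
    ∫⁻ ω in B, ENNReal.ofReal (Real.exp (tilt l (decay M (k + 1)) * endCount T (k + 1) ω))
        ∂law[|{ω | endCount T M ω = d}] ≤
      ∫⁻ ω in B, ENNReal.ofReal (Real.exp (tilt l (decay M k) * endCount T k ω))
        ∂law[|{ω | endCount T M ω = d}] := by
  have hA : MeasurableSet[past k] {ω | endCount T M ω = d} :=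
    past.mono hk _ (measurableSet_endCount_eq T M d)
  have hkT : k ∉ T := fun h => hk.not_gt (Finset.mem_range.1 (hT h))
  rw [setLIntegral_cond (past.le k _ hB), setLIntegral_cond (past.le k _ hB), decay_succ hk]
  gcongr _ * ?_
  exact setLIntegral_exp_mul_endCount_succ_le hkT
    (tilt_add_exp_sub_one_div_le hl (decay_pos hk).le (decay_le_one hk) (by positivity))
    (hB.inter hA)

lemma cond_real_exists_le_tilt_mul_le (hT : T ⊆ Finset.range M) (d : ℕ) {l : ℝ}
    (hl : |l| ≤ 1 / 5) (x : ℝ) :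
    (law[|{ω | endCount T M ω = d}]).real
        {ω | ∃ k, M ≤ k ∧ x ≤ tilt l (decay M k) * endCount T k ω} ≤
      Real.exp ((l + 2 * l ^ 2) * d - x) := by
  set ν := law[|{ω | endCount T M ω = d}]
  set X : ℕ → Choices → ℝ≥0∞ :=
    fun j ω => ENNReal.ofReal (Real.exp (tilt l (decay M (M + j)) * endCount T (M + j) ω))
  let ℱ : Filtration ℕ (MeasurableSpace.pi : MeasurableSpace Choices) :=
    ⟨fun j => past (M + j), fun _ _ h => past.mono (by gcongr), fun j => past.le (M + j)⟩
  have ville := mul_measure_exists_le_le_lintegral (μ := ν) (ℱ := ℱ) (X := X)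
    (fun j => (measurable_of_countable fun y : ℕ => ENNReal.ofReal
      (Real.exp (tilt l (decay M (M + j)) * y))).comp (measurable_endCount T (M + j)))
    (fun j B hB => setLIntegral_cond_exp_tilt_succ_le hT d hl (Nat.le_add_right M j) hB)
    (ENNReal.ofReal (Real.exp x))
  have hevent : {ω | ∃ j, ENNReal.ofReal (Real.exp x) ≤ X j ω} =
      {ω | ∃ k, M ≤ k ∧ x ≤ tilt l (decay M k) * endCount T k ω} := by
    ext ω
    simp only [X, ENNReal.ofReal_le_ofReal_iff (Real.exp_nonneg _), Real.exp_le_exp,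
      Set.mem_ofPred_eq]
    constructor
    · rintro ⟨j, hj⟩
      exact ⟨M + j, Nat.le_add_right M j, hj⟩
    · rintro ⟨k, hk, hx⟩
      obtain ⟨j, rfl⟩ := Nat.exists_eq_add_of_le hk
      exact ⟨j, hx⟩
  have hinit : ∫⁻ ω, X 0 ω ∂ν ≤ ENNReal.ofReal (Real.exp ((l + 2 * l ^ 2) * d)) := by
    calc ∫⁻ ω, X 0 ω ∂ν = ∫⁻ _, ENNReal.ofReal (Real.exp ((l + 2 * l ^ 2) * d)) ∂ν := by
          refine lintegral_congr_ae ?_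
          filter_upwards [ae_cond_mem (past.le M _ (measurableSet_endCount_eq T M d))] with ω hω
          have hω' : endCount T M ω = d := hω
          simp [X, hω', decay_self, tilt]
      _ ≤ ENNReal.ofReal (Real.exp ((l + 2 * l ^ 2) * d)) := by
          rw [lintegral_const]
          exact mul_le_of_le_one_right' prob_le_one
  rw [hevent] at ville
  have hreal := ENNReal.toReal_mono ENNReal.ofReal_ne_top (ville.trans hinit)
  rw [ENNReal.toReal_mul, ENNReal.toReal_ofReal (by positivity),
    ENNReal.toReal_ofReal (by positivity)] at hreal
  rwa [Real.exp_sub, le_div_iff₀' (Real.exp_pos x)]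

lemma cond_real_exists_one_add_mul_le (hT : T ⊆ Finset.range M) (hM : 0 < M) (d : ℕ) {ε : ℝ}
    (hε0 : 0 ≤ ε) (hε1 : ε ≤ 1) :
    (law[|{ω | endCount T M ω = d}]).real
        {ω | ∃ k, M ≤ k ∧ (1 + ε) * √(k / M) * d ≤ endCount T k ω} ≤
      Real.exp (-(ε ^ 2 / 32 * d)) := by
  have hl : |ε / 8| ≤ 1 / 5 := by rw [abs_of_nonneg (by positivity)]; linarith
  calc _ ≤ (law[|{ω | endCount T M ω = d}]).real {ω | ∃ k, M ≤ k ∧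
          ε / 8 * ((1 + ε) * d) ≤ tilt (ε / 8) (decay M k) * endCount T k ω} := by
        refine measureReal_mono ?_
        rintro ω ⟨k, hk, hω⟩
        have hu := (decay_pos hk).le
        refine ⟨k, hk, ?_⟩
        calc ε / 8 * ((1 + ε) * d)
            ≤ ε / 8 * ((decay M k * √(k / M)) * ((1 + ε) * d)) := by
              gcongr ε / 8 * ?_
              exact le_mul_of_one_le_left (by positivity) (one_le_decay_mul_sqrt hM hk)
          _ = ε / 8 * decay M k * ((1 + ε) * √(k / M) * d) := by ring
          _ ≤ ε / 8 * decay M k * endCount T k ω := by gcongr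
          _ ≤ tilt (ε / 8) (decay M k) * endCount T k ω := by gcongr; exact mul_le_tilt _ _
    _ ≤ Real.exp ((ε / 8 + 2 * (ε / 8) ^ 2) * d - ε / 8 * ((1 + ε) * d)) :=
        cond_real_exists_le_tilt_mul_le hT d hl _
    _ ≤ Real.exp (-(ε ^ 2 / 32 * d)) := by
        gcongr
        nlinarith [mul_nonneg (sq_nonneg ε) d.cast_nonneg (α := ℝ)]

lemma cond_real_exists_le_one_sub_mul_le (hT : T ⊆ Finset.range M) (d : ℕ) {ε : ℝ}
    (hε1 : ε ≤ 1) (hεM : 1 ≤ ε * M) :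
    (law[|{ω | endCount T M ω = d}]).real
        {ω | ∃ k, M ≤ k ∧ endCount T k ω ≤ (1 - ε) * √(k / M) * d} ≤
      Real.exp (-(ε ^ 2 / 32 * d)) := by
  have hε0 : 0 ≤ ε := (pos_of_mul_pos_left (one_pos.trans_le hεM) M.cast_nonneg).le
  have hl : |-(ε / 8)| ≤ 1 / 5 := by rw [abs_neg, abs_of_nonneg (by positivity)]; linarith
  calc _ ≤ (law[|{ω | endCount T M ω = d}]).real {ω | ∃ k, M ≤ k ∧
          -(ε / 8) * ((1 - ε / 2) * d) ≤ tilt (-(ε / 8)) (decay M k) * endCount T k ω} := by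
        refine measureReal_mono ?_
        rintro ω ⟨k, hk, hω⟩
        have hu := (decay_pos hk).le
        have hscaled : decay M k * endCount T k ω ≤ (1 - ε / 2) * d := by
          calc decay M k * endCount T k ω
              ≤ decay M k * ((1 - ε) * √(k / M) * d) := by gcongr
            _ = (1 - ε) * (decay M k * √(k / M)) * d := by ring
            _ ≤ (1 - ε / 2) * d := by
                gcongr
                exact one_sub_mul_decay_mul_sqrt_le hk hε1 hεM
        refine ⟨k, hk, ?_⟩
        calc -(ε / 8) * ((1 - ε / 2) * d)
            ≤ -(ε / 8) * (decay M k * endCount T k ω) :=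
              mul_le_mul_of_nonpos_left hscaled (by linarith)
          _ = -(ε / 8) * decay M k * endCount T k ω := by ring
          _ ≤ tilt (-(ε / 8)) (decay M k) * endCount T k ω := by gcongr; exact mul_le_tilt _ _
    _ ≤ Real.exp ((-(ε / 8) + 2 * (-(ε / 8)) ^ 2) * d - -(ε / 8) * ((1 - ε / 2) * d)) :=
        cond_real_exists_le_tilt_mul_le hT d hl _
    _ = Real.exp (-(ε ^ 2 / 32 * d)) := by ring_nf

lemma one_sub_two_mul_exp_le_cond_real_endCount (hT : T ⊆ Finset.range M) {d : ℕ} {ε : ℝ}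
    (hε1 : ε ≤ 1) (hεM : 1 ≤ ε * M) (hd : law {ω | endCount T M ω = d} ≠ 0) :
    1 - 2 * Real.exp (-(ε ^ 2 / 32 * d)) ≤
      (law[|{ω | endCount T M ω = d}]).real
        {ω | ∀ k, M ≤ k → (1 - ε) * √(k / M) * d < endCount T k ω ∧
          endCount T k ω < (1 + ε) * √(k / M) * d} := by
  have hε0 : 0 < ε := pos_of_mul_pos_left (one_pos.trans_le hεM) M.cast_nonneg
  have hM : 0 < M := Nat.cast_pos.1 (pos_of_mul_pos_right (one_pos.trans_le hεM) hε0.le)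
  have : IsProbabilityMeasure law[|{ω | endCount T M ω = d}] := cond_isProbabilityMeasure hd
  set ν := law[|{ω | endCount T M ω = d}]
  set good := {ω | ∀ k, M ≤ k → (1 - ε) * √(k / M) * d < endCount T k ω ∧
    endCount T k ω < (1 + ε) * √(k / M) * d}
  set low := {ω | ∃ k, M ≤ k ∧ endCount T k ω ≤ (1 - ε) * √(k / M) * d}
  set high := {ω | ∃ k, M ≤ k ∧ (1 + ε) * √(k / M) * d ≤ endCount T k ω}
  have hcover : Set.univ ⊆ good ∪ (low ∪ high) := by
    intro ω _
    by_cases hω : ω ∈ good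
    · exact Or.inl hω
    · simp only [good, Set.mem_ofPred_eq, not_forall, not_and_or, not_lt] at hω
      obtain ⟨k, hk, hlow | hhigh⟩ := hω
      · exact Or.inr (Or.inl ⟨k, hk, hlow⟩)
      · exact Or.inr (Or.inr ⟨k, hk, hhigh⟩)
  have hlow : ν.real low ≤ _ := cond_real_exists_le_one_sub_mul_le hT d hε1 hεM
  have hhigh : ν.real high ≤ _ := cond_real_exists_one_add_mul_le hT hM d hε0.le hε1
  have hone : 1 ≤ ν.real good + (ν.real low + ν.real high) := by
    calc 1 = ν.real Set.univ := probReal_univ.symm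
      _ ≤ ν.real (good ∪ (low ∪ high)) := measureReal_mono hcover
      _ ≤ ν.real good + ν.real (low ∪ high) := measureReal_union_le _ _
      _ ≤ ν.real good + (ν.real low + ν.real high) := by
          gcongr
          exact measureReal_union_le _ _
  linarith

end Tail

lemma two_le_log_fifteen_mul {x : ℝ} (hx : 1 ≤ x) : 2 ≤ Real.log (15 * x) := by
  rw [Real.le_log_iff_exp_le (by positivity)]
  calc Real.exp 2 = Real.exp 1 ^ 2 := by rw [← Real.exp_nat_mul]; norm_num
    _ ≤ 3 ^ 2 := by gcongr; exact Real.exp_one_lt_three.le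
    _ ≤ 15 * x := by linarith

lemma one_le_mul_of_one_div_pow_lt {ε x : ℝ} {k : ℕ} (hε : 0 < ε) (hε1 : ε ≤ 1) (hk : k ≠ 0)
    (h : 1 / ε ^ k < x) : 1 ≤ ε * x := by
  have hx : 0 < x := (by positivity : 0 < 1 / ε ^ k).trans h
  calc 1 ≤ ε ^ k * x := ((div_lt_iff₀' (by positivity)).1 h).le
    _ ≤ ε * x := by
        gcongr
        exact pow_le_of_le_one hε.le hε1 hk

end PrefAttach

open PrefAttach in
theorem mainTheorem3_general {ε : ℝ} {t m : ℕ} (S : Finset (Fin t)) (d : ℕ) (hε : ε ≤ 1)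
    (hεt : 1 ≤ ε * t) (hm : 1 ≤ m) (hd : law {ω | deg m S t le_rfl ω = d} ≠ 0) :
    1 - 2 * Real.exp (-(ε ^ 2 / 32 * d)) ≤
      (law[|{ω | deg m S t le_rfl ω = d}]).real
        {ω | ∀ (n : ℕ) (h : t ≤ n), (1 - ε) * √(n / t) * d < deg m S n h ω ∧
          deg m S n h ω < (1 + ε) * √(n / t) * d} := by
  have hm' : (1 : ℝ) ≤ m := by exact_mod_cast hm
  have hεM : 1 ≤ ε * (t * m : ℕ) := by
    rw [Nat.cast_mul, ← mul_assoc]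
    exact one_le_mul_of_one_le_of_one_le hεt hm'
  have hratio (n : ℕ) : ((n * m : ℕ) : ℝ) / (t * m : ℕ) = n / t := by
    rw [Nat.cast_mul, Nat.cast_mul, mul_div_mul_right _ _ (by positivity)]
  simp only [deg_eq_endCount] at hd ⊢
  refine (one_sub_two_mul_exp_le_cond_real_endCount (mergedInto_subset_range m S) hε hεM
    hd).trans (measureReal_mono fun ω hω n h => ?_)
  simpa only [hratio] using hω (n * m) (Nat.mul_le_mul_right m h)

theorem mainTheorem3 :
    ∃ C : ℕ, ∀ (ε : ℝ) (t m : ℕ) (S : Finset (Fin t)) (d : ℕ),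
      0 < ε → ε ≤ 1 / 40 → 1 / ε ^ 6 < (t : ℝ) → 1 ≤ m →
      PrefAttach.law {ω | PrefAttach.deg m S t le_rfl ω = d} ≠ 0 →
      1 - Real.log (15 * (t : ℝ)) * Real.exp (-(ε ^ C * (d : ℝ))) ≤
        (ProbabilityTheory.cond PrefAttach.law
            {ω | PrefAttach.deg m S t le_rfl ω = d}).real
          {ω | ∀ (n : ℕ) (h : t ≤ n),
            (1 - ε) * Real.sqrt ((n : ℝ) / (t : ℝ)) * (d : ℝ) < (PrefAttach.deg m S n h ω : ℝ) ∧
            (PrefAttach.deg m S n h ω : ℝ) < (1 + ε) * Real.sqrt ((n : ℝ) / (t : ℝ)) * (d : ℝ)} := by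
  refine ⟨3, fun ε t m S d hε hε1 ht hm hd => ?_⟩
  have hεt : 1 ≤ ε * t :=
    PrefAttach.one_le_mul_of_one_div_pow_lt hε (by linarith) (by norm_num) ht
  have ht1 : (1 : ℝ) ≤ t := hεt.trans (mul_le_of_le_one_left t.cast_nonneg (by linarith))
  have hlog : 2 ≤ Real.log (15 * t) := PrefAttach.two_le_log_fifteen_mul ht1
  have hpow : ε ^ 3 ≤ ε ^ 2 / 32 := by
    nlinarith [mul_nonneg (sq_nonneg ε) (sub_nonneg.2 hε1)]
  refine le_trans ?_ (mainTheorem3_general S d (by linarith) hεt hm hd)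
  gcongr
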